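/- Let $d\ge 2$, $1<\alpha<2$, $1<q<d+\alpha$ and $1<p<\infty$, and write points of $\mathbb R^{d+1}$ as $(t,x)$ with $t\in\mathbb R$, $x\in\mathbb R^d$. For $\rho>0$ let $C_\rho(t,x)=\{(s,y): t\le s\le t+\rho^\alpha,\ |y-x|\le\rho\}$. A function $v\in L^q_{\rm loc}(\mathbb R^{d+1})$ belongs to the Morrey class $E_q$ if $$\|v\|_{E_q}:=\sup_{\rho>0,\,(t,x)\in\mathbb R^{d+1}}\rho\Bigl(\frac1{|C_\rho(t,x)|}\int_{C_\rho(t,x)}|v(s,y)|^q\,ds\,dy\Bigr)^{1/q}<\infty .$$ For $\gamma>0$ let $$p_\gamma(t,x)=\mathbf 1_{\{t>0\}}\begin{cases} t^{\gamma/2}|x|^{-d-\alpha}, & |x|\ge t^{1/\alpha},\\ t^{\frac\gamma2-\frac{d+\alpha}{\alpha}}, & |x|<t^{1/\alpha},\end{cases}$$ and, for $f\in C_c(\mathbb R^{d+1})$, let $$P_\gamma f(t,x)=\int_{\mathbb R^{d+1}}p_\gamma(s,y)f(t+s,x+y)\,dy\,ds,\qquad P^*_\gamma f(t,x)=\int_{\mathbb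 R^{d+1}}p_\gamma(s,y)f(t-s,x+y)\,dy\,ds .$$ Then there is a constant $C>0$ depending only on $d,p,q,\alpha$ such that for every vector field $b:\mathbb R^{d+1}\to\mathbb R^d$ with $|b|^{\frac1{\alpha-1}}\in E_q$ and every real-valued $f\in C_c(\mathbb R^{d+1})$, with $\gamma=(1-\frac1\alpha)\frac2p$, the functions $|b|\,|P_\gamma f|^p$ and $|b|\,|P^*_\gamma f|^p$ are integrable on $\mathbb R^{d+1}$ and $$\int_{\mathbb R^{d+1}}|b|\,|P_\gamma f|^p\,dz\le C^p\,\bigl\||b|^{\frac1{\alpha-1}}\bigr\|_{E_q}^{\alpha-1}\|f\|_{L^p(\mathbb R^{d+1})}^p,\qquad \int_{\mathbb R^{d+1}}|b|\,|P^*_\gamma f|^p\,dz\le C^p\,\bigl\||b|^{\frac1{\alpha-1}}\bigr\|_{E_q}^{\alpha-1}\|f\|_{L^p(\mathbb R^{d+1})}^p .$$ -/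

import Mathlib

open MeasureTheory
open scoped ENNReal

namespace AdamsKrylov

noncomputable section

/-- Space-time `ℝ^{d+1}`: points `(t, x)` with `x` in Euclidean `ℝ^d`; `volume` is Lebesgue measure. -/
abbrev SpaceTime (d : ℕ) : Type := ℝ × EuclideanSpace ℝ (Fin d)

/-- The parabolic cylinder `C_ρ(t,x) = {(s,y) | t ≤ s ≤ t + ρ^α, |y - x| ≤ ρ}`. -/
def cylinder (d : ℕ) (α ρ : ℝ) (z : SpaceTime d) : Set (SpaceTime d) :=
  {w | z.1 ≤ w.1 ∧ w.1 ≤ z.1 + ρ ^ α ∧ ‖w.2 - z.2‖ ≤ ρ}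

/-- The Morrey norm `‖v‖_{E_q}`, the supremum over `ρ > 0` and `z` of
`ρ (|C_ρ(z)|⁻¹ ∫_{C_ρ(z)} |v|^q)^{1/q}`, with values in `[0, ∞]`. -/
def morreyNorm (d : ℕ) (α q : ℝ) (v : SpaceTime d → ℝ) : ℝ≥0∞ :=
  ⨆ (ρ : ℝ) (_ : 0 < ρ) (z : SpaceTime d),
    ENNReal.ofReal ρ *
      ((volume (cylinder d α ρ z))⁻¹ * ∫⁻ w in cylinder d α ρ z, ‖v w‖ₑ ^ q) ^ (1 / q)

/-- The Morrey class `E_q`: functions in `L^q_loc` with finite Morrey norm. -/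
structure MemMorrey (d : ℕ) (α q : ℝ) (v : SpaceTime d → ℝ) : Prop where
  aestronglyMeasurable : AEStronglyMeasurable v volume
  locallyIntegrable : LocallyIntegrable (fun z => |v z| ^ q) volume
  norm_lt_top : morreyNorm d α q v < ∞

/-- The model kernel `p_γ(t,x)`. -/
def kernel (d : ℕ) (α γ : ℝ) (z : SpaceTime d) : ℝ :=
  if 0 < z.1 then
    if z.1 ^ (1 / α) ≤ ‖z.2‖ then z.1 ^ (γ / 2) * ‖z.2‖ ^ (-(d : ℝ) - α)
    else z.1 ^ (γ / 2 - ((d : ℝ) + α) / α)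
  else 0

/-- `P_γ f(t,x) = ∫ p_γ(s,y) f(t+s, x+y) dy ds`. -/
def P (d : ℕ) (α γ : ℝ) (f : SpaceTime d → ℝ) (z : SpaceTime d) : ℝ :=
  ∫ w : SpaceTime d, kernel d α γ w * f (z.1 + w.1, z.2 + w.2)

/-- `P_γ^* f(t,x) = ∫ p_γ(s,y) f(t-s, x+y) dy ds`. -/
def PStar (d : ℕ) (α γ : ℝ) (f : SpaceTime d → ℝ) (z : SpaceTime d) : ℝ :=
  ∫ w : SpaceTime d, kernel d α γ w * f (z.1 - w.1, z.2 + w.2)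

end

end AdamsKrylov

namespace AdamsKrylov

open Set Metric Filter Topology

theorem lintegral_Ioc_rpow_sub_one {a R : ℝ} (ha : 0 < a) (hR : 0 ≤ R) :
    ∫⁻ t in Ioc 0 R, ENNReal.ofReal (t ^ (a - 1)) = ENNReal.ofReal (R ^ a / a) := by
  have hi : IntervalIntegrable (fun t : ℝ => t ^ (a - 1)) volume 0 R :=
    intervalIntegral.intervalIntegrable_rpow' (by linarith)
  rw [← ofReal_integral_eq_lintegral_ofReal ((intervalIntegrable_iff_integrableOn_Ioc_of_le hR).1 hi)
    ((ae_restrict_mem measurableSet_Ioc).mono fun t ht => Real.rpow_nonneg ht.1.le _),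
    ← intervalIntegral.integral_of_le hR, integral_rpow (Or.inl (by linarith))]
  simp [Real.zero_rpow ha.ne']

theorem lintegral_Ioi_rpow_neg_sub_one {b R : ℝ} (hb : 0 < b) (hR : 0 < R) :
    ∫⁻ t in Ioi R, ENNReal.ofReal (t ^ (-b - 1)) = ENNReal.ofReal (R ^ (-b) / b) := by
  rw [← ofReal_integral_eq_lintegral_ofReal (integrableOn_Ioi_rpow_of_lt (by linarith) hR)
    ((ae_restrict_mem measurableSet_Ioi).mono fun t ht =>
      Real.rpow_nonneg (hR.trans ht).le _), integral_Ioi_rpow_of_lt (by linarith) hR]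
  congr 1
  rw [sub_add_cancel, div_neg, neg_div, neg_neg]

/-- Splitting at the scale where the two terms of the minimum balance. -/
theorem lintegral_rpow_mul_min_le {a b : ℝ} (ha : 0 < a) (hab : a < b) (A D : ℝ≥0∞) :
    ∫⁻ t in Ioi (0 : ℝ), ENNReal.ofReal (t ^ (a - 1)) * min A (D * ENNReal.ofReal (t ^ (-b))) ≤
      ENNReal.ofReal (1 / a + 1 / (b - a)) * (A ^ (1 - a / b) * D ^ (a / b)) := by
  have hb : 0 < b := ha.trans hab
  have h1 : 0 < a / b := by positivity
  have h2 : 0 < 1 - a / b := by rw [sub_pos, div_lt_one hb]; exact hab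
  have h3 : 0 < 1 / a + 1 / (b - a) := by
    have := sub_pos.2 hab
    positivity
  rcases eq_or_ne A 0 with rfl | hA0
  · simp
  rcases eq_or_ne D 0 with rfl | hD0
  · simp
  have hC : ENNReal.ofReal (1 / a + 1 / (b - a)) ≠ 0 := by simpa using h3
  rcases eq_or_ne A ∞ with rfl | hA
  · rw [ENNReal.top_rpow_of_pos h2, ENNReal.top_mul (by simp [hD0, h1.le]), ENNReal.mul_top hC]
    exact le_top
  rcases eq_or_ne D ∞ with rfl | hD
  · rw [ENNReal.top_rpow_of_pos h1, ENNReal.mul_top (by simp [ENNReal.rpow_eq_zero_iff, hA0, hA]), ENNReal.mul_top hC]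
    exact le_top
  lift A to NNReal using hA
  lift D to NNReal using hD
  have hA0 : 0 < (A : ℝ) := by
    rw [NNReal.coe_pos, pos_iff_ne_zero]; exact_mod_cast hA0
  have hD0 : 0 < (D : ℝ) := by
    rw [NNReal.coe_pos, pos_iff_ne_zero]; exact_mod_cast hD0
  set R : ℝ := ((D : ℝ) / A) ^ (1 / b) with hRdef
  have hR : 0 < R := by positivity
  have key1 : (A : ℝ) * R ^ a = (A : ℝ) ^ (1 - a / b) * (D : ℝ) ^ (a / b) := by
    rw [hRdef, ← Real.rpow_mul (by positivity), one_div_mul_eq_div,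
      Real.div_rpow hD0.le hA0.le, Real.rpow_sub hA0, Real.rpow_one]
    ring
  have key2 : (D : ℝ) * R ^ (a - b) = (A : ℝ) ^ (1 - a / b) * (D : ℝ) ^ (a / b) := by
    rw [Real.rpow_sub hR, ← key1]
    have : R ^ b = D / A := by
      rw [hRdef, ← Real.rpow_mul (by positivity), one_div_mul_cancel hb.ne', Real.rpow_one]
    rw [this]
    field_simp
  rw [← Ioc_union_Ioi_eq_Ioi hR.le,
    lintegral_union measurableSet_Ioi (Ioc_disjoint_Ioi le_rfl)]
  have e1 : ∫⁻ t in Ioc 0 R, ENNReal.ofReal (t ^ (a - 1)) *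
      min (A : ℝ≥0∞) (D * ENNReal.ofReal (t ^ (-b))) ≤ ENNReal.ofReal (R ^ a / a) * A := by
    rw [← lintegral_Ioc_rpow_sub_one ha hR.le, ← lintegral_mul_const _ (by fun_prop)]
    gcongr
    exact min_le_left _ _
  have e2 : ∫⁻ t in Ioi R, ENNReal.ofReal (t ^ (a - 1)) *
      min (A : ℝ≥0∞) (D * ENNReal.ofReal (t ^ (-b))) ≤
        ENNReal.ofReal (R ^ (-(b - a)) / (b - a)) * D := by
    rw [← lintegral_Ioi_rpow_neg_sub_one (sub_pos.2 hab) hR, ← lintegral_mul_const _ (by fun_prop)]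
    refine setLIntegral_mono' measurableSet_Ioi fun t ht => ?_
    have ht : 0 < t := hR.trans ht
    calc _ ≤ ENNReal.ofReal (t ^ (a - 1)) * (D * ENNReal.ofReal (t ^ (-b))) := by
          gcongr
          exact min_le_right _ _
      _ = ENNReal.ofReal (t ^ (a - 1)) * ENNReal.ofReal (t ^ (-b)) * D := by ring
      _ = _ := by
        rw [← ENNReal.ofReal_mul (by positivity), ← Real.rpow_add ht]
        congr 3
        ring
  refine (add_le_add e1 e2).trans (le_of_eq ?_)
  have hba := sub_pos.2 hab
  rw [← ENNReal.ofReal_coe_nnreal, ← ENNReal.ofReal_coe_nnreal,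
    ENNReal.ofReal_rpow_of_pos hA0, ENNReal.ofReal_rpow_of_pos hD0,
    ← ENNReal.ofReal_mul (by positivity), ← ENNReal.ofReal_mul (by positivity),
    ← ENNReal.ofReal_mul (by positivity), ← ENNReal.ofReal_mul (by positivity),
    ← ENNReal.ofReal_add (by positivity) (by positivity)]
  congr 1
  rw [neg_sub, div_mul_eq_mul_div, div_mul_eq_mul_div, mul_comm _ (A : ℝ), mul_comm _ (D : ℝ), key1,
    key2]
  ring

section Maximal

variable {X : Type*} [MetricSpace X] [MeasurableSpace X]

/-- The uncentred maximal function of a measure, normalized by `r ^ Q`. -/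
noncomputable def maximalFunction (Q : ℝ) (ν : Measure X) (x : X) : ℝ≥0∞ :=
  ⨆ (y : X) (r : ℝ) (_ : 0 < r) (_ : x ∈ ball y r), ν (ball y r) / ENNReal.ofReal r ^ Q

theorem lt_maximalFunction_iff {Q : ℝ} {ν : Measure X} {x : X} {a : ℝ≥0∞} :
    a < maximalFunction Q ν x ↔
      ∃ y r, 0 < r ∧ x ∈ ball y r ∧ a < ν (ball y r) / ENNReal.ofReal r ^ Q := by
  simp only [maximalFunction, lt_iSup_iff, exists_prop]

theorem le_maximalFunction {Q : ℝ} {ν : Measure X} {x y : X} {r : ℝ} (hr : 0 < r)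
    (hx : x ∈ ball y r) : ν (ball y r) / ENNReal.ofReal r ^ Q ≤ maximalFunction Q ν x :=
  le_iSup_of_le y <| le_iSup_of_le r <| le_iSup_of_le hr <| le_iSup_of_le hx le_rfl

theorem measure_ball_le_maximalFunction_mul {Q : ℝ} (ν : Measure X) (x : X) {r : ℝ} (hr : 0 < r) :
    ν (ball x r) ≤ maximalFunction Q ν x * ENNReal.ofReal r ^ Q := by
  have h0 : ENNReal.ofReal r ^ Q ≠ 0 := by simp [ENNReal.rpow_eq_zero_iff, hr]
  have h1 : ENNReal.ofReal r ^ Q ≠ ∞ := by simp [ENNReal.rpow_eq_top_iff, hr]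
  rw [← ENNReal.div_le_iff h0 h1]
  exact le_maximalFunction hr (mem_ball_self hr)

theorem isOpen_lt_maximalFunction (Q : ℝ) (ν : Measure X) (a : ℝ≥0∞) :
    IsOpen {x | a < maximalFunction Q ν x} := by
  have : {x | a < maximalFunction Q ν x} =
      ⋃ (y : X) (r : ℝ) (_ : 0 < r) (_ : a < ν (ball y r) / ENNReal.ofReal r ^ Q), ball y r := by
    ext x
    simp only [mem_ofPred_eq, lt_maximalFunction_iff, mem_iUnion, exists_prop]
    tauto
  rw [this]
  exact isOpen_iUnion fun y => isOpen_iUnion fun r => isOpen_iUnion fun _ => isOpen_iUnion fun _ =>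
    isOpen_ball

variable [BorelSpace X]

@[fun_prop]
theorem measurable_maximalFunction (Q : ℝ) (ν : Measure X) : Measurable (maximalFunction Q ν) :=
  measurable_of_Ioi fun a => (isOpen_lt_maximalFunction Q ν a).measurableSet

variable [SecondCountableTopology X] {μ : Measure X} {Q : ℝ} {c : ℝ≥0∞}

/-- The weak type `(1, 1)` inequality. -/
theorem measure_lt_maximalFunction_le (hQ : 0 < Q)
    (hμ : ∀ (x : X) (r : ℝ), 0 < r → μ (ball x r) = c * ENNReal.ofReal r ^ Q)
    (ν : Measure X) [IsFiniteMeasure ν] {a : ℝ≥0∞} (ha : a ≠ 0) :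
    μ {x | a < maximalFunction Q ν x} ≤ c * ENNReal.ofReal 4 ^ Q * ν univ / a := by
  rcases eq_or_ne a ∞ with rfl | ha'
  · simp
  let t : Set (X × ℝ) := {i | 0 < i.2 ∧ a < ν (ball i.1 i.2) / ENNReal.ofReal i.2 ^ Q}
  have hlt : ∀ i ∈ t, a * ENNReal.ofReal i.2 ^ Q < ν (ball i.1 i.2) := by
    rintro ⟨y, r⟩ ⟨hr, h⟩
    exact (ENNReal.lt_div_iff_mul_lt (Or.inl (by simp [ENNReal.rpow_eq_zero_iff, hr]))
      (Or.inl (by simp [ENNReal.rpow_eq_top_iff, hr]))).1 h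
  have hR : ∀ i ∈ t, i.2 ≤ ((ν univ / a) ^ (1 / Q)).toReal := by
    rintro ⟨y, r⟩ hi
    have h1 : a * ENNReal.ofReal r ^ Q ≤ ν univ := (hlt _ hi).le.trans (measure_mono (subset_univ _))
    have h2 : ENNReal.ofReal r ^ Q ≤ ν univ / a := by
      rwa [ENNReal.le_div_iff_mul_le (Or.inl ha) (Or.inl ha'), mul_comm]
    have h3 : ENNReal.ofReal r ≤ (ν univ / a) ^ (1 / Q) := by
      rwa [one_div, ENNReal.le_rpow_inv_iff hQ]
    exact (ENNReal.ofReal_le_iff_le_toReal (ENNReal.rpow_ne_top_of_nonneg (by positivity)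
      (ENNReal.div_ne_top (measure_ne_top _ _) ha))).1 h3
  obtain ⟨u, hut, hdisj, hcov⟩ := Vitali.exists_disjoint_subfamily_covering_enlargement_ball t
    Prod.fst Prod.snd _ hR 4 (by norm_num)
  have hcount : u.Countable := hdisj.countable_of_isOpen (fun _ _ => isOpen_ball)
    fun i hi => ⟨i.1, mem_ball_self (hut hi).1⟩
  have hsub : {x | a < maximalFunction Q ν x} ⊆ ⋃ i ∈ u, ball i.1 (4 * i.2) := by
    intro x hx
    obtain ⟨y, r, hr, hxy, h⟩ := lt_maximalFunction_iff.1 hx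
    obtain ⟨i, hi, hsub⟩ := hcov (y, r) ⟨hr, h⟩
    exact mem_biUnion hi (hsub hxy)
  calc μ {x | a < maximalFunction Q ν x} ≤ μ (⋃ i ∈ u, ball i.1 (4 * i.2)) := measure_mono hsub
    _ ≤ ∑' i : u, μ (ball i.1.1 (4 * i.1.2)) := measure_biUnion_le _ hcount _
    _ ≤ ∑' i : u, c * ENNReal.ofReal 4 ^ Q / a * ν (ball i.1.1 i.1.2) := by
        refine ENNReal.tsum_le_tsum fun i => ?_
        have hi := hut i.2
        rw [hμ _ _ (by linarith [hi.1]), ENNReal.ofReal_mul (by norm_num),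
          ENNReal.mul_rpow_of_nonneg _ _ hQ.le, ← mul_assoc, ENNReal.mul_div_right_comm.symm,
          ENNReal.le_div_iff_mul_le (Or.inl ha) (Or.inl ha'), mul_assoc _ _ a, mul_comm _ a]
        gcongr
        exact (hlt _ hi).le
    _ = c * ENNReal.ofReal 4 ^ Q / a * ν (⋃ i ∈ u, ball i.1 i.2) := by
        rw [ENNReal.tsum_mul_left, measure_biUnion hcount hdisj fun _ _ => measurableSet_ball]
    _ ≤ c * ENNReal.ofReal 4 ^ Q / a * ν univ := by gcongr; exact subset_univ _
    _ = _ := ENNReal.mul_div_right_comm.symm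

/-- Kolmogorov's inequality. -/
theorem setLIntegral_maximalFunction_rpow_le (hQ : 0 < Q) (hc : c ≠ ∞)
    (hμ : ∀ (x : X) (r : ℝ), 0 < r → μ (ball x r) = c * ENNReal.ofReal r ^ Q)
    (ν : Measure X) [IsFiniteMeasure ν] {θ : ℝ} (hθ : 0 < θ) (hθ1 : θ < 1) (B : Set X) :
    ∫⁻ x in B, maximalFunction Q ν x ^ θ ∂μ ≤
      ENNReal.ofReal θ * ENNReal.ofReal (1 / θ + 1 / (1 - θ)) *
        (μ B ^ (1 - θ) * (c * ENNReal.ofReal 4 ^ Q * ν univ) ^ θ) := by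
  set D := c * ENNReal.ofReal 4 ^ Q * ν univ with hD
  have hDtop : D ≠ ∞ := by
    refine ENNReal.mul_ne_top (ENNReal.mul_ne_top hc ?_) (measure_ne_top _ _)
    exact ENNReal.rpow_ne_top_of_nonneg hQ.le ENNReal.ofReal_ne_top
  have hfin : ∀ᵐ x ∂μ, maximalFunction Q ν x ≠ ∞ := by
    have h : ∀ n : ℕ, μ {x | maximalFunction Q ν x = ∞} ≤ D / (n + 1 : ℕ) := fun n => by
      refine le_trans (measure_mono ?_)
        (measure_lt_maximalFunction_le hQ hμ ν (a := (n + 1 : ℕ)) (by simp))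
      intro x hx
      simp only [mem_ofPred_eq] at hx ⊢
      rw [hx]
      exact ENNReal.natCast_lt_top _
    have hlim : Tendsto (fun n : ℕ => D / (n + 1 : ℕ)) atTop (𝓝 0) := by
      have := (ENNReal.tendsto_inv_nat_nhds_zero.comp (tendsto_add_atTop_nat 1))
      simpa [div_eq_mul_inv] using ENNReal.Tendsto.const_mul this (Or.inr hDtop)
    have h0 := ge_of_tendsto' hlim h
    simpa [ae_iff] using h0
  have e : ∫⁻ x in B, maximalFunction Q ν x ^ θ ∂μ =
      ∫⁻ x in B, ENNReal.ofReal ((maximalFunction Q ν x).toReal ^ θ) ∂μ := by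
    refine lintegral_congr_ae (ae_restrict_of_ae (hfin.mono fun x hx => ?_))
    dsimp only
    rw [← ENNReal.ofReal_rpow_of_nonneg ENNReal.toReal_nonneg hθ.le, ENNReal.ofReal_toReal hx]
  rw [e, lintegral_rpow_eq_lintegral_meas_lt_mul _ (ae_of_all _ fun _ => ENNReal.toReal_nonneg)
    (by fun_prop) hθ, mul_assoc]
  gcongr
  have h1 := lintegral_rpow_mul_min_le hθ hθ1 (μ B) D
  rw [div_one] at h1
  refine le_trans (setLIntegral_mono' measurableSet_Ioi fun t ht => ?_) h1
  rw [mul_comm]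
  gcongr
  have ht : 0 < t := ht
  refine le_min ((measure_mono (subset_univ _)).trans (by simp)) ?_
  rw [Real.rpow_neg_one, ENNReal.ofReal_inv_of_pos ht, ← div_eq_mul_inv]
  refine (Measure.restrict_apply_le _ _).trans ((measure_mono ?_).trans
    (measure_lt_maximalFunction_le hQ hμ ν (a := ENNReal.ofReal t) (by simpa using ht)))
  intro x hx
  have hx : t < (maximalFunction Q ν x).toReal := hx
  refine (ENNReal.ofReal_lt_iff_lt_toReal ht.le fun h => ?_).2 hx
  rw [h, ENNReal.toReal_top] at hx
  exact ht.not_gt hx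

end Maximal

theorem ofReal_rpow_ne_zero {r : ℝ} (hr : 0 < r) (s : ℝ) : ENNReal.ofReal r ^ s ≠ 0 := by
  simp [ENNReal.rpow_eq_zero_iff, hr]

theorem ofReal_rpow_ne_top {r : ℝ} (hr : 0 < r) (s : ℝ) : ENNReal.ofReal r ^ s ≠ ∞ := by
  simp [ENNReal.rpow_eq_top_iff, hr]

theorem ofReal_rpow_sub_le {ρ t Q l : ℝ} (hρ : 0 < ρ) (ht : ρ ≤ t) (hl : 0 ≤ l) :
    ENNReal.ofReal t ^ (Q - l) ≤ ENNReal.ofReal ρ ^ (-l) * ENNReal.ofReal t ^ Q := by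
  rw [sub_eq_neg_add, ENNReal.rpow_add _ _ (by simpa using hρ.trans_le ht) ENNReal.ofReal_ne_top,
    ENNReal.rpow_neg, ENNReal.rpow_neg]
  gcongr

section Schur

variable {X : Type*} [MeasurableSpace X] {μ : Measure X} [SFinite μ]

/-- Schur's test with a weight: it suffices to find one positive supersolution `ψ`. -/
theorem lintegral_mul_rpow_lintegral_le_of_schur {k : X → X → ℝ≥0∞}
    (hk : Measurable (Function.uncurry k)) (hsymm : ∀ x y, k x y = k y x) {p : ℝ} (hp : 1 < p)
    {w ψ f : X → ℝ≥0∞} (hw : Measurable w) (hψ : Measurable ψ) (hf : Measurable f)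
    (hψ0 : ∀ᵐ x ∂μ, ψ x ≠ 0) (hψtop : ∀ᵐ x ∂μ, ψ x ≠ ∞) {C : ℝ≥0∞}
    (h : ∀ x, ∫⁻ y, k x y * (w y * (∫⁻ z, k y z * ψ z ∂μ) ^ (p - 1)) ∂μ ≤ C * ψ x ^ (p - 1)) :
    ∫⁻ x, w x * (∫⁻ y, k x y * f y ∂μ) ^ p ∂μ ≤ C * ∫⁻ x, f x ^ p ∂μ := by
  have hp0 : 0 < p := by linarith
  have hp1 : 0 < p - 1 := by linarith
  have hpq : (p / (p - 1)).HolderConjugate p := (Real.HolderConjugate.conjExponent hp).symm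
  have hkx : ∀ x, Measurable (k x) := fun x => hk.comp measurable_prodMk_left
  set g : X → ℝ≥0∞ := fun y => f y ^ p * ψ y ^ (-(p - 1)) with hg
  have hgm : Measurable g := by fun_prop
  have hIψ : Measurable fun x => ∫⁻ y, k x y * ψ y ∂μ :=
    Measurable.lintegral_prod_right' (f := fun z : X × X => k z.1 z.2 * ψ z.2)
      (hk.mul (hψ.comp measurable_snd))
  have holder : ∀ x, (∫⁻ y, k x y * f y ∂μ) ^ p ≤
      (∫⁻ y, k x y * ψ y ∂μ) ^ (p - 1) * ∫⁻ y, k x y * g y ∂μ := by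
    intro x
    have e : ∫⁻ y, k x y * f y ∂μ =
        ∫⁻ y, ((fun y => (k x y * ψ y) ^ ((p - 1) / p)) * fun y => (k x y * g y) ^ (1 / p)) y ∂μ := by
      refine lintegral_congr_ae ?_
      filter_upwards [hψ0, hψtop] with y h0 ht
      have hs : 0 ≤ (p - 1) / p := by positivity
      have hs' : 0 ≤ 1 / p := by positivity
      simp only [Pi.mul_apply, hg]
      rw [ENNReal.mul_rpow_of_nonneg _ _ hs, ENNReal.mul_rpow_of_nonneg _ _ hs',
        ENNReal.mul_rpow_of_nonneg _ _ hs', ← ENNReal.rpow_mul, ← ENNReal.rpow_mul,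
        mul_one_div_cancel hp0.ne', ENNReal.rpow_one]
      have e1 : k x y ^ ((p - 1) / p) * k x y ^ (1 / p) = k x y := by
        rw [← ENNReal.rpow_add_of_nonneg _ _ hs hs', ← add_div, sub_add_cancel, div_self hp0.ne',
          ENNReal.rpow_one]
      have e2 : ψ y ^ ((p - 1) / p) * ψ y ^ (-(p - 1) * (1 / p)) = 1 := by
        rw [← ENNReal.rpow_add _ _ h0 ht]
        convert ENNReal.rpow_zero using 2
        ring
      calc k x y * f y = (k x y ^ ((p - 1) / p) * k x y ^ (1 / p)) * f y *
            (ψ y ^ ((p - 1) / p) * ψ y ^ (-(p - 1) * (1 / p))) := by rw [e1, e2, mul_one]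
        _ = _ := by ring
    have H := ENNReal.lintegral_mul_le_Lp_mul_Lq μ hpq
      (f := fun y => (k x y * ψ y) ^ ((p - 1) / p)) (g := fun y => (k x y * g y) ^ (1 / p))
      (by have := hkx x; fun_prop) (by have := hkx x; fun_prop)
    rw [← e] at H
    have E1 : ∀ y, ((k x y * ψ y) ^ ((p - 1) / p)) ^ (p / (p - 1)) = k x y * ψ y := fun y => by
      rw [← ENNReal.rpow_mul, div_mul_div_cancel₀ hp0.ne', div_self hp1.ne', ENNReal.rpow_one]
    have E2 : ∀ y, ((k x y * g y) ^ (1 / p)) ^ p = k x y * g y := fun y => by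
      rw [← ENNReal.rpow_mul, one_div_mul_cancel hp0.ne', ENNReal.rpow_one]
    simp only [E1, E2] at H
    calc (∫⁻ y, k x y * f y ∂μ) ^ p
        ≤ ((∫⁻ y, k x y * ψ y ∂μ) ^ (1 / (p / (p - 1))) * (∫⁻ y, k x y * g y ∂μ) ^ (1 / p)) ^ p := by
          gcongr
      _ = _ := by
          rw [ENNReal.mul_rpow_of_nonneg _ _ hp0.le, ← ENNReal.rpow_mul, ← ENNReal.rpow_mul,
            one_div_mul_cancel hp0.ne', ENNReal.rpow_one, one_div_div, div_mul_cancel₀ _ hp0.ne']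
  calc ∫⁻ x, w x * (∫⁻ y, k x y * f y ∂μ) ^ p ∂μ
      ≤ ∫⁻ x, ∫⁻ y, g y * (k y x * (w x * (∫⁻ z, k x z * ψ z ∂μ) ^ (p - 1))) ∂μ ∂μ := by
        refine lintegral_mono fun x => ?_
        calc _ ≤ w x * ((∫⁻ y, k x y * ψ y ∂μ) ^ (p - 1) * ∫⁻ y, k x y * g y ∂μ) := by
              gcongr; exact holder x
          _ = ∫⁻ y, (w x * (∫⁻ y, k x y * ψ y ∂μ) ^ (p - 1)) * (k x y * g y) ∂μ := by
              rw [← mul_assoc, lintegral_const_mul (f := fun y => k x y * g y) _ ((hkx x).mul hgm)]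
          _ = _ := lintegral_congr fun y => by rw [hsymm x y]; ring
    _ = ∫⁻ y, ∫⁻ x, g y * (k y x * (w x * (∫⁻ z, k x z * ψ z ∂μ) ^ (p - 1))) ∂μ ∂μ := by
        refine lintegral_lintegral_swap (Measurable.aemeasurable ?_)
        exact (hgm.comp measurable_snd).mul ((hk.comp measurable_swap).mul
          ((hw.comp measurable_fst).mul ((hIψ.comp measurable_fst).pow_const _)))
    _ = ∫⁻ y, g y * ∫⁻ x, k y x * (w x * (∫⁻ z, k x z * ψ z ∂μ) ^ (p - 1)) ∂μ ∂μ :=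
        lintegral_congr fun y => lintegral_const_mul _ ((hkx y).mul (hw.mul (hIψ.pow_const _)))
    _ ≤ ∫⁻ y, g y * (C * ψ y ^ (p - 1)) ∂μ := by gcongr with y; exact h y
    _ = ∫⁻ y, C * f y ^ p ∂μ := by
        refine lintegral_congr_ae ?_
        filter_upwards [hψ0, hψtop] with y h0 ht
        have : ψ y ^ (-(p - 1)) * ψ y ^ (p - 1) = 1 := by
          rw [← ENNReal.rpow_add _ _ h0 ht, neg_add_cancel, ENNReal.rpow_zero]
        calc g y * (C * ψ y ^ (p - 1)) = C * f y ^ p * (ψ y ^ (-(p - 1)) * ψ y ^ (p - 1)) := by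
              simp only [hg]; ring
          _ = _ := by rw [this, mul_one]
    _ = _ := lintegral_const_mul _ (hf.pow_const _)

end Schur

section Metric

variable {X : Type*} [MetricSpace X] [MeasurableSpace X]

theorem isLocallyFiniteMeasure_of_measure_ball_ne_top {ν : Measure X}
    (h : ∀ x : X, ν (ball x 1) ≠ ∞) : IsLocallyFiniteMeasure ν :=
  ⟨fun x => ⟨ball x 1, ball_mem_nhds x one_pos, (h x).lt_top⟩⟩

theorem maximalFunction_ne_zero {Q : ℝ} {ν : Measure X} (hν : ν ≠ 0) (x : X) :
    maximalFunction Q ν x ≠ 0 := by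
  intro h
  refine hν (Measure.measure_univ_eq_zero.1 ?_)
  rw [← iUnion_ball_nat_succ x, measure_iUnion_null_iff]
  intro n
  have := measure_ball_le_maximalFunction_mul (Q := Q) ν x (r := (n : ℝ) + 1) (by positivity)
  rw [h, zero_mul] at this
  exact le_antisymm this zero_le

theorem isUnifLocDoublingMeasure_of_measure_ball {μ : Measure X} {Q : ℝ} {c : ℝ≥0∞} (hQ : 0 < Q)
    (hμ : ∀ (x : X) (r : ℝ), 0 < r → μ (ball x r) = c * ENNReal.ofReal r ^ Q) :
    IsUnifLocDoublingMeasure μ := by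
  refine ⟨(4 : NNReal) ^ Q, eventually_nhdsWithin_of_forall fun ε hε x => ?_⟩
  have hε : 0 < ε := hε
  calc μ (closedBall x (2 * ε)) ≤ μ (ball x (4 * ε)) :=
        measure_mono (closedBall_subset_ball (by linarith))
    _ = ENNReal.ofReal 4 ^ Q * μ (ball x ε) := by
        rw [hμ _ _ (by linarith), hμ _ _ hε, ENNReal.ofReal_mul (by norm_num),
          ENNReal.mul_rpow_of_nonneg _ _ hQ.le]
        ring
    _ ≤ _ := by
        rw [ENNReal.coe_rpow_of_nonneg _ hQ.le]
        gcongr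
        · simp
        · exact ball_subset_closedBall

end Metric

section Potential

variable {X : Type*} [MetricSpace X] [MeasurableSpace X] [BorelSpace X] [SecondCountableTopology X]
  {μ : Measure X} {Q : ℝ} {c : ℝ≥0∞}

/-- Averages of fractional powers of the maximal function are controlled by the averages over
larger concentric balls. -/
theorem exists_setLIntegral_ball_maximalFunction_rpow_le (hQ : 0 < Q) (hc : c ≠ ∞)
    (hμ : ∀ (x : X) (r : ℝ), 0 < r → μ (ball x r) = c * ENNReal.ofReal r ^ Q)
    {θ : ℝ} (hθ : 0 < θ) (hθ1 : θ < 1) :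
    ∃ C : ℝ≥0∞, C ≠ ∞ ∧ ∀ (ν : Measure X) (x : X) (ρ : ℝ) (N : ℝ≥0∞), 0 < ρ →
      (∀ t, ρ ≤ t → ν (ball x t) ≤ N * ENNReal.ofReal t ^ Q) →
      ∫⁻ w in ball x ρ, maximalFunction Q ν w ^ θ ∂μ ≤ C * (N ^ θ * ENNReal.ofReal ρ ^ Q) := by
  set K := ENNReal.ofReal θ * ENNReal.ofReal (1 / θ + 1 / (1 - θ))
  set L : ℝ≥0∞ := ENNReal.ofReal 3 ^ Q
  have hL : L ≠ ∞ := ofReal_rpow_ne_top (by norm_num) _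
  have hL0 : L ≠ 0 := ofReal_rpow_ne_zero (by norm_num) _
  set F : ℝ≥0∞ := ENNReal.ofReal 4 ^ Q
  have hF : F ≠ ∞ := ofReal_rpow_ne_top (by norm_num) _
  have h1θ : 0 < 1 - θ := by linarith
  refine ⟨K * (c ^ (1 - θ) * (c * F * L) ^ θ) + L ^ θ * c, ?_, ?_⟩
  · have hK : K ≠ ∞ := ENNReal.mul_ne_top ENNReal.ofReal_ne_top ENNReal.ofReal_ne_top
    have h1 : c ^ (1 - θ) ≠ ∞ := ENNReal.rpow_ne_top_of_nonneg h1θ.le hc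
    have h2 : (c * F * L) ^ θ ≠ ∞ := ENNReal.rpow_ne_top_of_nonneg hθ.le
      (ENNReal.mul_ne_top (ENNReal.mul_ne_top hc hF) hL)
    have h3 : L ^ θ ≠ ∞ := ENNReal.rpow_ne_top_of_nonneg hθ.le hL
    exact ENNReal.add_ne_top.2 ⟨ENNReal.mul_ne_top hK (ENNReal.mul_ne_top h1 h2),
      ENNReal.mul_ne_top h3 hc⟩
  intro ν x ρ N hρ hN
  set P : ℝ≥0∞ := ENNReal.ofReal ρ ^ Q with hP
  have hP0 : P ≠ 0 := ofReal_rpow_ne_zero hρ _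
  have hPt : P ≠ ∞ := ofReal_rpow_ne_top hρ _
  have h3ρ : ENNReal.ofReal (3 * ρ) ^ Q = L * P := by
    rw [ENNReal.ofReal_mul (by norm_num), ENNReal.mul_rpow_of_nonneg _ _ hQ.le]
  rcases eq_or_ne (K * (c ^ (1 - θ) * (c * F * L) ^ θ) + L ^ θ * c) 0 with h0 | h0
  · have hc0 : c = 0 := by
      have : L ^ θ ≠ 0 := by simp [ENNReal.rpow_eq_zero_iff, hL0, hL]
      simpa [this] using (add_eq_zero.1 h0).2
    have : μ (ball x ρ) = 0 := by rw [hμ x ρ hρ, hc0, zero_mul]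
    rw [Measure.restrict_eq_zero.2 this]
    simp
  rcases eq_or_ne N ∞ with rfl | hNt
  · rw [ENNReal.top_rpow_of_pos hθ, ENNReal.top_mul hP0, ENNReal.mul_top h0]
    exact le_top
  set ν' := ν.restrict (ball x (3 * ρ)) with hν'
  have hν'u : ν' univ ≤ N * (L * P) := by
    rw [hν', Measure.restrict_apply_univ, ← h3ρ]
    exact hN _ (by linarith)
  have : IsFiniteMeasure ν' := ⟨hν'u.trans_lt (ENNReal.mul_lt_top hNt.lt_top
    (ENNReal.mul_lt_top hL.lt_top hPt.lt_top))⟩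
  have hpt : ∀ w ∈ ball x ρ, maximalFunction Q ν w ≤ max (maximalFunction Q ν' w) (L * N) := by
    intro w hw
    refine iSup_le fun y => iSup_le fun r => iSup_le fun hr => iSup_le fun hwy => ?_
    rw [mem_ball] at hw hwy
    rcases le_total r ρ with hrρ | hrρ
    · refine le_max_of_le_left (le_trans (le_of_eq ?_) (le_maximalFunction hr hwy))
      rw [hν', Measure.restrict_eq_self]
      refine ball_subset_ball' ?_
      linarith [dist_triangle y w x, dist_comm y w]
    · refine le_max_of_le_right ?_
      rw [ENNReal.div_le_iff (ofReal_rpow_ne_zero hr _) (ofReal_rpow_ne_top hr _)]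
      calc ν (ball y r) ≤ ν (ball x (3 * r)) := by
            refine measure_mono (ball_subset_ball' ?_)
            linarith [dist_triangle y w x, dist_comm y w]
        _ ≤ N * ENNReal.ofReal (3 * r) ^ Q := hN _ (by linarith)
        _ = _ := by
          rw [ENNReal.ofReal_mul (by norm_num), ENNReal.mul_rpow_of_nonneg _ _ hQ.le]
          ring
  calc ∫⁻ w in ball x ρ, maximalFunction Q ν w ^ θ ∂μ
      ≤ ∫⁻ w in ball x ρ, (maximalFunction Q ν' w ^ θ + (L * N) ^ θ) ∂μ := by
        refine setLIntegral_mono' measurableSet_ball fun w hw => ?_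
        refine (ENNReal.rpow_le_rpow (hpt w hw) hθ.le).trans ?_
        rcases max_choice (maximalFunction Q ν' w) (L * N) with h | h <;> rw [h]
        exacts [le_self_add, le_add_self]
    _ = ∫⁻ w in ball x ρ, maximalFunction Q ν' w ^ θ ∂μ + (L * N) ^ θ * μ (ball x ρ) := by
        rw [lintegral_add_right _ measurable_const, setLIntegral_const]
    _ ≤ K * ((c * P) ^ (1 - θ) * (c * F * (N * (L * P))) ^ θ) + (L * N) ^ θ * (c * P) := by
        rw [← hμ x ρ hρ]
        gcongr
        refine (setLIntegral_maximalFunction_rpow_le hQ hc hμ ν' hθ hθ1 _).trans ?_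
        gcongr
    _ = _ := by
        have e1 : c * F * (N * (L * P)) = (c * F * L) * N * P := by ring
        have e2 : P ^ (1 - θ) * P ^ θ = P := by
          rw [← ENNReal.rpow_add_of_nonneg _ _ h1θ.le hθ.le, sub_add_cancel, ENNReal.rpow_one]
        rw [e1, ENNReal.mul_rpow_of_nonneg _ P h1θ.le, ENNReal.mul_rpow_of_nonneg _ P hθ.le,
          ENNReal.mul_rpow_of_nonneg _ N hθ.le, ENNReal.mul_rpow_of_nonneg _ N hθ.le]
        calc _ = K * (c ^ (1 - θ) * (c * F * L) ^ θ) * (N ^ θ * (P ^ (1 - θ) * P ^ θ)) +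
              L ^ θ * c * (N ^ θ * P) := by ring
          _ = _ := by rw [e2]; ring

/-- A potential is controlled by the integrals over balls. -/
theorem lintegral_dist_rpow_mul_le [SFinite μ] {β : ℝ} (hβ : β < Q) {g : X → ℝ≥0∞}
    (hg : Measurable g) (x : X) :
    ∫⁻ y, ENNReal.ofReal (dist x y ^ (β - Q)) * g y ∂μ ≤
      ENNReal.ofReal (Q - β) *
        ∫⁻ t in Ioi (0 : ℝ), ENNReal.ofReal (t ^ (β - Q - 1)) * ∫⁻ y in ball x t, g y ∂μ := by
  have hQβ : 0 < Q - β := sub_pos.2 hβ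
  have hk : ∀ y, ENNReal.ofReal (dist x y ^ (β - Q)) ≤ ENNReal.ofReal (Q - β) *
      ∫⁻ t in Ioi (0 : ℝ), (Ioi (dist x y)).indicator
        (fun t => ENNReal.ofReal (t ^ (β - Q - 1))) t := by
    intro y
    rcases dist_nonneg.eq_or_lt' (a := dist x y) with h | h
    · rw [h, Real.zero_rpow (by linarith)]; simp
    · rw [setLIntegral_indicator measurableSet_Ioi,
        inter_eq_left.2 (Ioi_subset_Ioi h.le),
        show β - Q - 1 = -(Q - β) - 1 by ring, lintegral_Ioi_rpow_neg_sub_one hQβ h,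
        ← ENNReal.ofReal_mul hQβ.le, mul_div_cancel₀ _ hQβ.ne', neg_sub]
  calc ∫⁻ y, ENNReal.ofReal (dist x y ^ (β - Q)) * g y ∂μ
      ≤ ∫⁻ y, (ENNReal.ofReal (Q - β) * ∫⁻ t in Ioi (0 : ℝ), (Ioi (dist x y)).indicator
        (fun t => ENNReal.ofReal (t ^ (β - Q - 1))) t * g y) ∂μ := by
        refine lintegral_mono fun y => ?_
        rw [lintegral_mul_const _ (Measurable.indicator (by fun_prop) measurableSet_Ioi),
          ← mul_assoc]
        gcongr
        exact hk y
    _ = ENNReal.ofReal (Q - β) * ∫⁻ y, (∫⁻ t in Ioi (0 : ℝ), (Ioi (dist x y)).indicator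
        (fun t => ENNReal.ofReal (t ^ (β - Q - 1))) t * g y) ∂μ :=
        lintegral_const_mul' _ _ ENNReal.ofReal_ne_top
    _ = ENNReal.ofReal (Q - β) * ∫⁻ t in Ioi (0 : ℝ), ∫⁻ y, ((Ioi (dist x y)).indicator
        (fun t => ENNReal.ofReal (t ^ (β - Q - 1))) t * g y) ∂μ := by
        congr 1
        refine lintegral_lintegral_swap (Measurable.aemeasurable ?_)
        refine Measurable.mul ?_ (hg.comp measurable_fst)
        have hs : MeasurableSet {z : X × ℝ | dist x z.1 < z.2} :=
          measurableSet_lt (by fun_prop) measurable_snd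
        exact Measurable.indicator (f := fun z : X × ℝ => ENNReal.ofReal (z.2 ^ (β - Q - 1)))
          (by fun_prop) hs
    _ = _ := by
        congr 1
        refine lintegral_congr fun t => ?_
        rw [← lintegral_const_mul _ hg, ← lintegral_indicator measurableSet_ball]
        refine lintegral_congr fun y => ?_
        by_cases h : dist x y < t
        · rw [indicator_of_mem (mem_Ioi.2 h), indicator_of_mem (by rwa [mem_ball'])]
        · rw [indicator_of_notMem (mt mem_Ioi.1 h), indicator_of_notMem (by rwa [mem_ball']), zero_mul]

/-- Fractional powers of the maximal function of a measure satisfying a Morrey condition are, up to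
an explicit power, supersolutions of the potential operator. -/
theorem exists_potential_maximalFunction_rpow_le [SFinite μ] (hc : c ≠ ∞)
    (hμ : ∀ (x : X) (r : ℝ), 0 < r → μ (ball x r) = c * ENNReal.ofReal r ^ Q)
    {β l θ : ℝ} (hβ : 0 < β) (hβQ : β < Q) (hl : 0 < l) (hθ : β / l < θ) (hθ1 : θ < 1) :
    ∃ C : ℝ≥0∞, C ≠ ∞ ∧ ∀ (ν : Measure X) (H : ℝ≥0∞),
      (∀ (x : X) (t : ℝ), 0 < t → ν (ball x t) ≤ H * ENNReal.ofReal t ^ (Q - l)) →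
      ∀ x, ∫⁻ y, ENNReal.ofReal (dist x y ^ (β - Q)) * maximalFunction Q ν y ^ θ ∂μ ≤
        C * (H ^ (β / l) * maximalFunction Q ν x ^ (θ - β / l)) := by
  have hQ : 0 < Q := hβ.trans hβQ
  have hθ0 : 0 < θ := (div_pos hβ hl).trans hθ
  have hab : β < l * θ := by rwa [div_lt_iff₀' hl] at hθ
  obtain ⟨C, hC, hball⟩ := exists_setLIntegral_ball_maximalFunction_rpow_le hQ hc hμ hθ0 hθ1
  refine ⟨ENNReal.ofReal (Q - β) * (C * ENNReal.ofReal (1 / β + 1 / (l * θ - β))), ?_, ?_⟩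
  · exact ENNReal.mul_ne_top ENNReal.ofReal_ne_top (ENNReal.mul_ne_top hC ENNReal.ofReal_ne_top)
  intro ν H hH x
  refine (lintegral_dist_rpow_mul_le hβQ (by fun_prop) x).trans ?_
  rw [mul_assoc, mul_assoc]
  gcongr
  set m := maximalFunction Q ν x
  have e : H ^ (β / l) * m ^ (θ - β / l) =
      (m ^ θ) ^ (1 - β / (l * θ)) * (H ^ θ) ^ (β / (l * θ)) := by
    rw [← ENNReal.rpow_mul, ← ENNReal.rpow_mul, mul_comm]
    congr 2 <;> field_simp
  rw [e]
  refine le_trans ?_ (mul_le_mul_right (lintegral_rpow_mul_min_le hβ hab (m ^ θ) (H ^ θ)) C)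
  rw [← lintegral_const_mul' _ _ hC]
  refine setLIntegral_mono' measurableSet_Ioi fun t ht => ?_
  have ht : 0 < t := ht
  have hb := hball ν x t (min m (H * ENNReal.ofReal t ^ (-l))) ht fun s hs => by
    have hs0 := ht.trans_le hs
    rcases min_choice m (H * ENNReal.ofReal t ^ (-l)) with h | h <;> rw [h]
    · exact measure_ball_le_maximalFunction_mul ν x hs0
    · refine (hH x s hs0).trans ?_
      rw [mul_assoc]
      gcongr
      exact ofReal_rpow_sub_le ht hs hl.le
  have hmin : min m (H * ENNReal.ofReal t ^ (-l)) ^ θ =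
      min (m ^ θ) (H ^ θ * ENNReal.ofReal (t ^ (-(l * θ)))) := by
    rw [(ENNReal.monotone_rpow_of_nonneg hθ0.le).map_min, ENNReal.mul_rpow_of_nonneg _ _ hθ0.le,
      ← ENNReal.rpow_mul, ENNReal.ofReal_rpow_of_pos ht, neg_mul]
  rw [hmin] at hb
  calc _ ≤ ENNReal.ofReal (t ^ (β - Q - 1)) *
        (C * (min (m ^ θ) (H ^ θ * ENNReal.ofReal (t ^ (-(l * θ)))) * ENNReal.ofReal t ^ Q)) := by
        gcongr
    _ = C * ((ENNReal.ofReal (t ^ (β - Q - 1)) * ENNReal.ofReal t ^ Q) *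
          min (m ^ θ) (H ^ θ * ENNReal.ofReal (t ^ (-(l * θ))))) := by ring
    _ = _ := by
      rw [ENNReal.ofReal_rpow_of_pos ht, ← ENNReal.ofReal_mul (by positivity), ← Real.rpow_add ht]
      rw [show β - Q - 1 + Q = β - 1 by ring]

/-- A density is dominated by the maximal function. -/
theorem ae_le_maximalFunction_withDensity (hQ : 0 < Q) (hc : c ≠ ∞)
    (hμ : ∀ (x : X) (r : ℝ), 0 < r → μ (ball x r) = c * ENNReal.ofReal r ^ Q) [SigmaFinite μ]
    {U : X → ℝ≥0∞} (hU : AEMeasurable U μ)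
    (hfin : ∀ x : X, μ.withDensity U (ball x 1) ≠ ∞) :
    ∀ᵐ x ∂μ, U x ≤ ENNReal.ofReal 2 ^ Q / c * maximalFunction Q (μ.withDensity U) x := by
  have := isUnifLocDoublingMeasure_of_measure_ball hQ hμ
  have := isLocallyFiniteMeasure_of_measure_ball_ne_top hfin
  have : IsLocallyFiniteMeasure μ := isLocallyFiniteMeasure_of_measure_ball_ne_top fun x => by
    rw [hμ x 1 one_pos]
    simp [hc]
  filter_upwards [VitaliFamily.ae_tendsto_rnDeriv (IsUnifLocDoublingMeasure.vitaliFamily μ 1)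
    (μ.withDensity U), Measure.rnDeriv_withDensity₀ μ hU] with x hx hUx
  rw [hUx] at hx
  have hlim := hx.comp (IsUnifLocDoublingMeasure.tendsto_closedBall_filterAt (K := 1) μ
    (l := 𝓝[>] (0 : ℝ)) (fun _ => x) (fun t => t) tendsto_id
    (eventually_nhdsWithin_of_forall fun t ht => by
      simpa using (le_of_lt ht : (0 : ℝ) ≤ t)))
  refine le_of_tendsto hlim (eventually_nhdsWithin_of_forall fun t ht => ?_)
  have ht : 0 < t := ht
  have hT0 := ofReal_rpow_ne_zero ht Q
  have hTt := ofReal_rpow_ne_top ht Q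
  set ν := μ.withDensity U
  calc ν (closedBall x t) / μ (closedBall x t) ≤ ν (ball x (2 * t)) / μ (ball x t) := by
        gcongr
        · exact closedBall_subset_ball (by linarith)
        · exact ball_subset_closedBall
    _ ≤ maximalFunction Q ν x * ENNReal.ofReal (2 * t) ^ Q / (c * ENNReal.ofReal t ^ Q) := by
        rw [hμ x t ht]
        gcongr
        exact measure_ball_le_maximalFunction_mul ν x (by linarith)
    _ = (maximalFunction Q ν x * ENNReal.ofReal 2 ^ Q) * ENNReal.ofReal t ^ Q /
          (c * ENNReal.ofReal t ^ Q) := by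
        rw [ENNReal.ofReal_mul (by norm_num), ENNReal.mul_rpow_of_nonneg _ _ hQ.le, mul_assoc]
    _ = maximalFunction Q ν x * ENNReal.ofReal 2 ^ Q / c := ENNReal.mul_div_mul_right _ _ hT0 hTt
    _ = _ := by rw [mul_comm, ENNReal.mul_div_right_comm]

/-- The trace inequality of Fefferman and Phong for potentials on a space with
`μ (ball x r) = c * r ^ Q`. -/
theorem exists_lintegral_mul_potential_rpow_le [SigmaFinite μ] (hc : c ≠ ∞) (hc0 : c ≠ 0)
    (hμ : ∀ (x : X) (r : ℝ), 0 < r → μ (ball x r) = c * ENNReal.ofReal r ^ Q)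
    {β p r : ℝ} (hβ : 0 < β) (hβQ : β < Q) (hp : 1 < p) (hr : 1 < r) :
    ∃ C : ℝ≥0∞, C ≠ ∞ ∧ ∀ (V : X → ℝ≥0∞) (H : ℝ≥0∞), AEMeasurable V μ → H ≠ ∞ →
      (∀ (x : X) (t : ℝ), 0 < t →
        ∫⁻ y in ball x t, V y ^ r ∂μ ≤ H * ENNReal.ofReal t ^ (Q - β * p * r)) →
      ∀ f : X → ℝ≥0∞, Measurable f →
        ∫⁻ x, V x * (∫⁻ y, ENNReal.ofReal (dist x y ^ (β - Q)) * f y ∂μ) ^ p ∂μ ≤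
          C * H ^ (1 / r) * ∫⁻ x, f x ^ p ∂μ := by
  have hQ : 0 < Q := hβ.trans hβQ
  have hp0 : 0 < p := by linarith
  have hp1 : 0 < p - 1 := by linarith
  have hr0 : 0 < r := by linarith
  set l := β * p * r with hl
  have hl0 : 0 < l := by positivity
  set σ := β / l with hσ
  have hσr : σ * p = 1 / r := by
    rw [hσ, hl]
    field_simp
  have hσ0 : 0 < σ := by positivity
  have hr1 : 1 / r < 1 := by rwa [div_lt_one hr0]
  have hσ1 : σ < 1 := by nlinarith
  obtain ⟨ε, hε0, hε1, hε2⟩ : ∃ ε : ℝ, 0 < ε ∧ σ + ε < 1 ∧ 1 / r + ε * (p - 1) < 1 := by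
    refine ⟨min ((1 - σ) / 2) ((1 - 1 / r) / (2 * (p - 1))), ?_, ?_, ?_⟩
    · refine lt_min (by linarith) (div_pos (by linarith) (by linarith))
    · linarith [min_le_left ((1 - σ) / 2) ((1 - 1 / r) / (2 * (p - 1)))]
    · have h1 := min_le_right ((1 - σ) / 2) ((1 - 1 / r) / (2 * (p - 1)))
      have h2 : (1 - 1 / r) / (2 * (p - 1)) * (p - 1) = (1 - 1 / r) / 2 := by field_simp
      nlinarith
  set θ := σ + ε with hθ
  set θ' := 1 / r + ε * (p - 1) with hθ'
  have hσθ' : σ < θ' := by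
    have : 0 < ε * (p - 1) := by positivity
    nlinarith
  have hexp : θ' - σ = θ * (p - 1) := by rw [hθ', hθ, ← hσr]; ring
  have hθ0 : 0 < θ := by positivity
  obtain ⟨C₁, hC₁, h₁⟩ := exists_potential_maximalFunction_rpow_le (θ := θ) hc hμ hβ hβQ hl0
    (by linarith) hε1
  obtain ⟨C₂, hC₂, h₂⟩ := exists_potential_maximalFunction_rpow_le (θ := θ') hc hμ hβ hβQ hl0
    hσθ' hε2
  obtain ⟨C₃, hC₃, h₃⟩ := exists_setLIntegral_ball_maximalFunction_rpow_le hQ hc hμ hθ0 hε1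
  set C₀ := ENNReal.ofReal 2 ^ Q / c with hC₀def
  have hC₀ : C₀ ≠ ∞ := ENNReal.div_ne_top (ofReal_rpow_ne_top (by norm_num) _) hc0
  refine ⟨C₀ ^ (1 / r) * (C₁ ^ (p - 1) * C₂), ?_, ?_⟩
  · exact ENNReal.mul_ne_top (ENNReal.rpow_ne_top_of_nonneg (by positivity) hC₀)
      (ENNReal.mul_ne_top (ENNReal.rpow_ne_top_of_nonneg hp1.le hC₁) hC₂)
  intro V H hV hH hVH f hf
  set ν := μ.withDensity fun y => V y ^ r with hν
  have hνball : ∀ (x : X) (t : ℝ), 0 < t → ν (ball x t) ≤ H * ENNReal.ofReal t ^ (Q - l) := by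
    intro x t ht
    rw [hν, withDensity_apply _ measurableSet_ball]
    exact hVH x t ht
  have hle := ae_le_maximalFunction_withDensity hQ hc hμ (hV.pow_const r) fun x =>
    ((hνball x 1 one_pos).trans_lt (by simpa using hH.lt_top)).ne
  rw [← hν] at hle
  set m := maximalFunction Q ν with hm
  have hVm : ∀ᵐ x ∂μ, V x ≤ C₀ ^ (1 / r) * m x ^ (1 / r) := by
    filter_upwards [hle] with x hx
    have := ENNReal.rpow_le_rpow hx (z := 1 / r) (by positivity)
    rwa [← ENNReal.rpow_mul, mul_one_div_cancel hr0.ne', ENNReal.rpow_one,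
      ENNReal.mul_rpow_of_nonneg _ _ (by positivity)] at this
  rcases eq_or_ne ν 0 with hν0 | hν0
  · have : ∀ᵐ x ∂μ, V x = 0 := by
      have hU := (withDensity_eq_zero_iff (hV.pow_const r)).1 (hν.symm.trans hν0)
      filter_upwards [hU] with x hx
      exact (ENNReal.rpow_eq_zero_iff_of_pos hr0).1 hx
    rw [lintegral_congr_ae (g := 0) (by filter_upwards [this] with x hx; simp [hx])]
    simp
  have hmtop : ∀ᵐ x ∂μ, m x ≠ ∞ := by
    rcases isEmpty_or_nonempty X with hX | ⟨⟨x₀⟩⟩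
    · exact ae_of_all _ fun x => isEmptyElim x
    have hn : ∀ n : ℕ, ∀ᵐ x ∂μ, x ∈ ball x₀ (n + 1) → m x ≠ ∞ := by
      intro n
      have hn0 : (0 : ℝ) < n + 1 := by positivity
      have hb := h₃ ν x₀ (n + 1) (H * ENNReal.ofReal (n + 1) ^ (-l)) hn0 fun t ht => by
        refine (hνball x₀ t (hn0.trans_le ht)).trans ?_
        rw [mul_assoc]
        gcongr
        exact ofReal_rpow_sub_le hn0 ht hl0.le
      have hfin : ∫⁻ w in ball x₀ (n + 1), m w ^ θ ∂μ ≠ ∞ := by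
        refine (hb.trans_lt (ENNReal.mul_lt_top hC₃.lt_top (ENNReal.mul_lt_top ?_ ?_))).ne
        · exact (ENNReal.rpow_ne_top_of_nonneg hθ0.le
            (ENNReal.mul_ne_top hH (ofReal_rpow_ne_top hn0 _))).lt_top
        · exact (ofReal_rpow_ne_top hn0 _).lt_top
      have := ae_lt_top ((measurable_maximalFunction Q ν).pow_const θ) hfin
      rw [ae_restrict_iff' measurableSet_ball] at this
      filter_upwards [this] with x hx hxb hxt
      have h' := hx hxb
      rw [← hm, hxt, ENNReal.top_rpow_of_pos hθ0] at h'
      exact h'.ne rfl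
    filter_upwards [ae_all_iff.2 hn] with x hx
    have hxu : x ∈ ⋃ n : ℕ, ball x₀ (n + 1) := by rw [iUnion_ball_nat_succ]; trivial
    obtain ⟨n, hxn⟩ := mem_iUnion.1 hxu
    exact hx n hxn
  have hmeas : Measurable m := measurable_maximalFunction Q ν
  have schur := lintegral_mul_rpow_lintegral_le_of_schur (μ := μ)
    (k := fun x y => ENNReal.ofReal (dist x y ^ (β - Q)))
    (by simp only [Function.uncurry_def]; fun_prop) (fun x y => by rw [dist_comm]) hp
    (w := fun x => m x ^ (1 / r)) (ψ := fun x => m x ^ θ) (f := f)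
    (hmeas.pow_const _) (hmeas.pow_const _) hf
    (hmtop.mono fun x hx => by
      simp [ENNReal.rpow_eq_zero_iff, maximalFunction_ne_zero hν0 x, hm, hθ0.not_gt])
    (hmtop.mono fun x hx => ENNReal.rpow_ne_top_of_nonneg hθ0.le hx)
    (C := C₁ ^ (p - 1) * C₂ * H ^ (1 / r)) (fun x => by
      calc _ ≤ ∫⁻ y, (C₁ ^ (p - 1) * H ^ (σ * (p - 1))) *
              (ENNReal.ofReal (dist x y ^ (β - Q)) * m y ^ θ') ∂μ := by
            refine lintegral_mono fun y => ?_
            calc _ ≤ ENNReal.ofReal (dist x y ^ (β - Q)) * (m y ^ (1 / r) *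
                    (C₁ * (H ^ σ * m y ^ (θ - σ))) ^ (p - 1)) := by
                  gcongr
                  exact h₁ ν H hνball y
              _ = (C₁ ^ (p - 1) * H ^ (σ * (p - 1))) * (ENNReal.ofReal (dist x y ^ (β - Q)) *
                    (m y ^ (1 / r) * m y ^ ((θ - σ) * (p - 1)))) := by
                  rw [ENNReal.mul_rpow_of_nonneg _ _ hp1.le, ENNReal.mul_rpow_of_nonneg _ _ hp1.le,
                    ← ENNReal.rpow_mul, ← ENNReal.rpow_mul]
                  ring
              _ = _ := by
                  rw [← ENNReal.rpow_add_of_nonneg _ _ (by positivity)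
                    (mul_nonneg (by linarith) hp1.le), hθ', hθ, add_sub_cancel_left]
        _ = (C₁ ^ (p - 1) * H ^ (σ * (p - 1))) *
              ∫⁻ y, ENNReal.ofReal (dist x y ^ (β - Q)) * m y ^ θ' ∂μ :=
            lintegral_const_mul _ (by fun_prop)
        _ ≤ (C₁ ^ (p - 1) * H ^ (σ * (p - 1))) * (C₂ * (H ^ σ * m x ^ (θ' - σ))) := by
            gcongr
            exact h₂ ν H hνball x
        _ = (C₁ ^ (p - 1) * C₂ * (H ^ (σ * (p - 1)) * H ^ σ)) * m x ^ (θ' - σ) := by ring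
        _ = _ := by
            rw [← ENNReal.rpow_add_of_nonneg _ _ (by positivity) hσ0.le, hexp, ENNReal.rpow_mul,
              ← hσr]
            ring_nf)
  calc _ ≤ ∫⁻ x, C₀ ^ (1 / r) *
          (m x ^ (1 / r) * (∫⁻ y, ENNReal.ofReal (dist x y ^ (β - Q)) * f y ∂μ) ^ p) ∂μ := by
        refine lintegral_mono_ae ?_
        filter_upwards [hVm] with x hx
        rw [← mul_assoc]
        gcongr
    _ = C₀ ^ (1 / r) * ∫⁻ x,
          m x ^ (1 / r) * (∫⁻ y, ENNReal.ofReal (dist x y ^ (β - Q)) * f y ∂μ) ^ p ∂μ :=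
        lintegral_const_mul' _ _ (ENNReal.rpow_ne_top_of_nonneg (by positivity) hC₀)
    _ ≤ C₀ ^ (1 / r) * (C₁ ^ (p - 1) * C₂ * H ^ (1 / r) * ∫⁻ x, f x ^ p ∂μ) := by gcongr
    _ = _ := by ring

end Potential

/-- The parabolic gauge `max (|t| ^ (1 / α)) |x|`. -/
noncomputable def parabolicNorm {d : ℕ} (α : ℝ) (z : SpaceTime d) : ℝ :=
  max (|z.1| ^ (1 / α)) ‖z.2‖

theorem parabolicNorm_lt_iff {d : ℕ} {α ρ : ℝ} (hα : 0 < α) (hρ : 0 < ρ) (z : SpaceTime d) :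
    parabolicNorm α z < ρ ↔ |z.1| < ρ ^ α ∧ ‖z.2‖ < ρ := by
  rw [parabolicNorm, max_lt_iff, one_div, Real.rpow_inv_lt_iff_of_pos (abs_nonneg _) hρ.le hα]

theorem isEmbedding_toSnowflaking_prod (d : ℕ) {a : ℝ} (ha0 : 0 < a) (ha1 : a ≤ 1) :
    IsEmbedding fun z : SpaceTime d =>
      ((Snowflaking.toSnowflaking z.1 : Snowflaking ℝ a ha0 ha1), z.2) :=
  (Snowflaking.homeomorph.symm.isEmbedding (X := ℝ) (Y := Snowflaking ℝ a ha0 ha1)).prodMap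
    (IsEmbedding.id (X := EuclideanSpace ℝ (Fin d)))

/-- The metric on space-time given by the parabolic gauge. -/
noncomputable abbrev parabolicMetric (d : ℕ) {α : ℝ} (hα : 1 < α) : MetricSpace (SpaceTime d) :=
  (isEmbedding_toSnowflaking_prod d (a := 1 / α) (by positivity)
    ((div_le_one (by positivity)).2 hα.le)).comapMetricSpace _

theorem parabolicMetric_dist (d : ℕ) {α : ℝ} (hα : 1 < α) (z w : SpaceTime d) :
    @dist _ (parabolicMetric d hα).toDist z w = parabolicNorm α (z - w) := by
  change max (dist (Snowflaking.toSnowflaking z.1 : Snowflaking ℝ (1 / α) _ _)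
    (Snowflaking.toSnowflaking w.1)) (dist z.2 w.2) = _
  rw [Snowflaking.dist_toSnowflaking_toSnowflaking, Real.dist_eq, dist_eq_norm]
  rfl

theorem volume_parabolicNorm_sub_lt (d : ℕ) {α ρ : ℝ} (hα : 0 < α) (hρ : 0 < ρ)
    (z : SpaceTime d) :
    volume {w : SpaceTime d | parabolicNorm α (w - z) < ρ} =
      2 * volume (ball (0 : EuclideanSpace ℝ (Fin d)) 1) * ENNReal.ofReal ρ ^ ((d : ℝ) + α) := by
  have : {w : SpaceTime d | parabolicNorm α (w - z) < ρ} = ball z.1 (ρ ^ α) ×ˢ ball z.2 ρ := by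
    ext w
    simp [parabolicNorm_lt_iff hα hρ, dist_eq_norm]
  rw [this, Measure.volume_eq_prod, Measure.prod_prod, Real.volume_ball,
    Measure.addHaar_ball_of_pos _ _ hρ, finrank_euclideanSpace_fin,
    ENNReal.rpow_add _ _ (by simpa using hρ) ENNReal.ofReal_ne_top, ENNReal.rpow_natCast,
    ENNReal.ofReal_rpow_of_pos hρ, ENNReal.ofReal_mul (by norm_num), ENNReal.ofReal_pow hρ.le,
    ENNReal.ofReal_ofNat]
  ring

theorem volume_cylinder (d : ℕ) {α ρ : ℝ} (hρ : 0 < ρ) (z : SpaceTime d) :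
    volume (cylinder d α ρ z) =
      volume (ball (0 : EuclideanSpace ℝ (Fin d)) 1) * ENNReal.ofReal ρ ^ ((d : ℝ) + α) := by
  have : cylinder d α ρ z = Icc z.1 (z.1 + ρ ^ α) ×ˢ closedBall z.2 ρ := by
    ext w
    simp [cylinder, dist_eq_norm, and_assoc]
  rw [this, Measure.volume_eq_prod, Measure.prod_prod, Real.volume_Icc,
    Measure.addHaar_closedBall _ _ hρ.le, finrank_euclideanSpace_fin,
    ENNReal.rpow_add _ _ (by simpa using hρ) ENNReal.ofReal_ne_top, ENNReal.rpow_natCast,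
    ENNReal.ofReal_rpow_of_pos hρ, ENNReal.ofReal_pow hρ.le, add_sub_cancel_left]
  ring

theorem setLIntegral_cylinder_le {d : ℕ} {α q ρ : ℝ} (hq : 0 < q) (hρ : 0 < ρ)
    (v : SpaceTime d → ℝ) (z : SpaceTime d) :
    ∫⁻ w in cylinder d α ρ z, ‖v w‖ₑ ^ q ≤
      volume (ball (0 : EuclideanSpace ℝ (Fin d)) 1) * morreyNorm d α q v ^ q *
        ENNReal.ofReal ρ ^ ((d : ℝ) + α - q) := by
  set u := volume (ball (0 : EuclideanSpace ℝ (Fin d)) 1)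
  have hu0 : u ≠ 0 := (measure_ball_pos _ _ one_pos).ne'
  have hut : u ≠ ∞ := measure_ball_lt_top.ne
  have hP0 := ofReal_rpow_ne_zero hρ ((d : ℝ) + α)
  have hPt := ofReal_rpow_ne_top hρ ((d : ℝ) + α)
  have hρ0 : ENNReal.ofReal ρ ≠ 0 := by simpa using hρ
  have h : ENNReal.ofReal ρ * ((volume (cylinder d α ρ z))⁻¹ *
      ∫⁻ w in cylinder d α ρ z, ‖v w‖ₑ ^ q) ^ (1 / q) ≤ morreyNorm d α q v :=
    le_iSup_of_le ρ <| le_iSup_of_le hρ <| le_iSup_of_le z le_rfl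
  set J := ∫⁻ w in cylinder d α ρ z, ‖v w‖ₑ ^ q
  have h1 := ENNReal.rpow_le_rpow h hq.le
  rw [ENNReal.mul_rpow_of_nonneg _ _ hq.le, ← ENNReal.rpow_mul, one_div_mul_cancel hq.ne',
    ENNReal.rpow_one, volume_cylinder d hρ] at h1
  set P := ENNReal.ofReal ρ ^ ((d : ℝ) + α)
  have e : J = u * P * (ENNReal.ofReal ρ ^ (-q) * (ENNReal.ofReal ρ ^ q * ((u * P)⁻¹ * J))) := by
    rw [← mul_assoc (ENNReal.ofReal ρ ^ (-q)), ← ENNReal.rpow_add _ _ hρ0 ENNReal.ofReal_ne_top,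
      neg_add_cancel, ENNReal.rpow_zero, one_mul, ← mul_assoc,
      ENNReal.mul_inv_cancel (mul_ne_zero hu0 hP0) (ENNReal.mul_ne_top hut hPt), one_mul]
  rw [e, sub_eq_add_neg, ENNReal.rpow_add _ _ hρ0 ENNReal.ofReal_ne_top]
  calc _ ≤ u * P * (ENNReal.ofReal ρ ^ (-q) * morreyNorm d α q v ^ q) := by gcongr
    _ = _ := by ring

theorem setLIntegral_parabolicNorm_sub_lt_le {d : ℕ} {α q ρ : ℝ} (hα : 0 < α) (hq : 0 < q)
    (hρ : 0 < ρ) (v : SpaceTime d → ℝ) (z : SpaceTime d) :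
    ∫⁻ w in {w | parabolicNorm α (w - z) < ρ}, ‖v w‖ₑ ^ q ≤
      2 * volume (ball (0 : EuclideanSpace ℝ (Fin d)) 1) * morreyNorm d α q v ^ q *
        ENNReal.ofReal ρ ^ ((d : ℝ) + α - q) := by
  have hsub : {w | parabolicNorm α (w - z) < ρ} ⊆
      cylinder d α ρ z ∪ cylinder d α ρ (z.1 - ρ ^ α, z.2) := by
    intro w hw
    obtain ⟨h1, h2⟩ := (parabolicNorm_lt_iff hα hρ _).1 hw
    rw [Prod.fst_sub, abs_lt] at h1
    rcases le_total z.1 w.1 with h | h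
    · exact Or.inl ⟨h, by linarith [h1.2], h2.le⟩
    · exact Or.inr ⟨by dsimp only; linarith [h1.1], by dsimp only; linarith, h2.le⟩
  refine (lintegral_mono_set hsub).trans ((lintegral_union_le _ _ _).trans ?_)
  refine (add_le_add (setLIntegral_cylinder_le hq hρ v _)
    (setLIntegral_cylinder_le hq hρ v _)).trans (le_of_eq ?_)
  ring

/-- The trace inequality for parabolic potentials. -/
theorem exists_lintegral_mul_parabolicPotential_rpow_le (d : ℕ) {α β p r : ℝ} (hα : 1 < α)
    (hβ : 0 < β) (hβQ : β < d + α) (hp : 1 < p) (hr : 1 < r) :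
    ∃ C : ℝ≥0∞, C ≠ ∞ ∧ ∀ (V : SpaceTime d → ℝ≥0∞) (H : ℝ≥0∞), AEMeasurable V volume → H ≠ ∞ →
      (∀ (z : SpaceTime d) (t : ℝ), 0 < t →
        ∫⁻ y in {y | parabolicNorm α (y - z) < t}, V y ^ r ≤
          H * ENNReal.ofReal t ^ ((d : ℝ) + α - β * p * r)) →
      ∀ f : SpaceTime d → ℝ≥0∞, Measurable f →
        ∫⁻ x, V x * (∫⁻ y, ENNReal.ofReal (parabolicNorm α (x - y) ^ (β - (d + α))) * f y) ^ p ≤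
          C * H ^ (1 / r) * ∫⁻ x, f x ^ p := by
  have hb : ∀ (x : SpaceTime d) (t : ℝ), @ball _ (parabolicMetric d hα).toPseudoMetricSpace x t =
      {y | parabolicNorm α (y - x) < t} := by
    intro x t
    ext y
    rw [mem_ofPred_eq, ← parabolicMetric_dist d hα]
    rfl
  have hBorel : @BorelSpace (SpaceTime d)
      (parabolicMetric d hα).toPseudoMetricSpace.toUniformSpace.toTopologicalSpace _ :=
    inferInstanceAs (BorelSpace (ℝ × EuclideanSpace ℝ (Fin d)))
  have hSC : @SecondCountableTopology (SpaceTime d)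
      (parabolicMetric d hα).toPseudoMetricSpace.toUniformSpace.toTopologicalSpace :=
    inferInstanceAs (SecondCountableTopology (ℝ × EuclideanSpace ℝ (Fin d)))
  have := @exists_lintegral_mul_potential_rpow_le (SpaceTime d) (parabolicMetric d hα) _ hBorel hSC
    volume ((d : ℝ) + α) (2 * volume (ball (0 : EuclideanSpace ℝ (Fin d)) 1)) inferInstance
    (ENNReal.mul_ne_top (by simp) measure_ball_lt_top.ne)
    (mul_ne_zero (by simp) (measure_ball_pos _ _ one_pos).ne')
    (fun x t ht => by rw [hb]; exact volume_parabolicNorm_sub_lt d (by linarith) ht x)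
    β p r hβ hβQ hp hr
  simpa only [hb, parabolicMetric_dist] using this

theorem measurable_kernel (d : ℕ) (α γ : ℝ) : Measurable (kernel d α γ) := by
  unfold kernel
  refine Measurable.ite (measurableSet_lt (by fun_prop) (by fun_prop))
    (Measurable.ite (measurableSet_le (by fun_prop) (by fun_prop)) (by fun_prop) (by fun_prop))
    measurable_const

theorem kernel_nonneg (d : ℕ) (α γ : ℝ) (z : SpaceTime d) : 0 ≤ kernel d α γ z := by
  unfold kernel
  split_ifs <;> positivity

theorem kernel_le_parabolicNorm_rpow {d : ℕ} {α β γ : ℝ} (hβ : 0 < β)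
    (hγ : γ / 2 = β / α) (z : SpaceTime d) :
    kernel d α γ z ≤ parabolicNorm α z ^ (β - (d + α)) := by
  unfold kernel
  split_ifs with h0 h
  · have hz : 0 < ‖z.2‖ := lt_of_lt_of_le (by positivity) h
    have : parabolicNorm α z = ‖z.2‖ := by
      rw [parabolicNorm, abs_of_pos h0, max_eq_right h]
    rw [this, show β - (d + α) = β + (-(d : ℝ) - α) by ring, Real.rpow_add hz, hγ,
      div_eq_mul_one_div, mul_comm β, Real.rpow_mul h0.le]
    gcongr
  · have : parabolicNorm α z = z.1 ^ (1 / α) := by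
      rw [parabolicNorm, abs_of_pos h0, max_eq_left (not_le.1 h).le]
    rw [this, ← Real.rpow_mul h0.le, hγ]
    apply le_of_eq
    congr 1
    ring
  · exact Real.rpow_nonneg (le_max_of_le_right (norm_nonneg _)) _

theorem enorm_integral_kernel_mul_comp_le {d : ℕ} {α β γ : ℝ} (hβ : 0 < β)
    (hγ : γ / 2 = β / α) {f : SpaceTime d → ℝ} (hf : Measurable f) (z : SpaceTime d)
    {T : SpaceTime d → SpaceTime d} (hT : MeasurePreserving T)
    (hTz : ∀ w, parabolicNorm α (z - T w) = parabolicNorm α w) :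
    ‖∫ w, kernel d α γ w * f (T w)‖ₑ ≤
      ∫⁻ y, ENNReal.ofReal (parabolicNorm α (z - y) ^ (β - (d + α))) * ‖f y‖ₑ := by
  have hm : Measurable fun y : SpaceTime d =>
      ENNReal.ofReal (parabolicNorm α (z - y) ^ (β - (d + α))) * ‖f y‖ₑ := by
    unfold parabolicNorm
    fun_prop
  rw [← hT.lintegral_comp hm]
  refine (enorm_integral_le_lintegral_enorm _).trans (lintegral_mono fun w => ?_)
  rw [enorm_mul, Real.enorm_of_nonneg (kernel_nonneg d α γ w), hTz]
  gcongr
  exact kernel_le_parabolicNorm_rpow hβ hγ w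

theorem enorm_P_le {d : ℕ} {α β γ : ℝ} (hβ : 0 < β)
    (hγ : γ / 2 = β / α) {f : SpaceTime d → ℝ} (hf : Measurable f) (z : SpaceTime d) :
    ‖P d α γ f z‖ₑ ≤
      ∫⁻ y, ENNReal.ofReal (parabolicNorm α (z - y) ^ (β - (d + α))) * ‖f y‖ₑ :=
  enorm_integral_kernel_mul_comp_le hβ hγ hf z (T := fun w => (z.1 + w.1, z.2 + w.2))
    ((measurePreserving_add_left volume z.1).prod (measurePreserving_add_left volume z.2))
    fun w => by simp [parabolicNorm]

theorem enorm_PStar_le {d : ℕ} {α β γ : ℝ} (hβ : 0 < β)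
    (hγ : γ / 2 = β / α) {f : SpaceTime d → ℝ} (hf : Measurable f) (z : SpaceTime d) :
    ‖PStar d α γ f z‖ₑ ≤
      ∫⁻ y, ENNReal.ofReal (parabolicNorm α (z - y) ^ (β - (d + α))) * ‖f y‖ₑ :=
  enorm_integral_kernel_mul_comp_le hβ hγ hf z (T := fun w => (z.1 - w.1, z.2 + w.2))
    ((Measure.measurePreserving_sub_left volume z.1).prod (measurePreserving_add_left volume z.2))
    fun w => by simp [parabolicNorm]

theorem stronglyMeasurable_P (d : ℕ) (α γ : ℝ) {f : SpaceTime d → ℝ} (hf : Measurable f) :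
    StronglyMeasurable (P d α γ f) := by
  have hk := measurable_kernel d α γ
  have h : Measurable fun z : SpaceTime d × SpaceTime d =>
    kernel d α γ z.2 * f (z.1.1 + z.2.1, z.1.2 + z.2.2) := by fun_prop
  exact h.stronglyMeasurable.integral_prod_right'

theorem stronglyMeasurable_PStar (d : ℕ) (α γ : ℝ) {f : SpaceTime d → ℝ} (hf : Measurable f) :
    StronglyMeasurable (PStar d α γ f) := by
  have hk := measurable_kernel d α γ
  have h : Measurable fun z : SpaceTime d × SpaceTime d =>
    kernel d α γ z.2 * f (z.1.1 - z.2.1, z.1.2 + z.2.2) := by fun_prop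
  exact h.stronglyMeasurable.integral_prod_right'

theorem aemeasurable_enorm_of_norm_rpow {Y E : Type*} [MeasurableSpace Y] {μ : Measure Y}
    [NormedAddCommGroup E] {b : Y → E} {s : ℝ} (hs : s ≠ 0)
    (h : AEStronglyMeasurable (fun z => ‖b z‖ ^ s) μ) : AEMeasurable (fun z => ‖b z‖ₑ) μ := by
  have : (fun z => ‖b z‖ₑ) = fun z => ENNReal.ofReal ((‖b z‖ ^ s) ^ s⁻¹) := by
    ext z
    rw [Real.rpow_rpow_inv (norm_nonneg _) hs, ofReal_norm]
  rw [this]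
  exact (h.aemeasurable.pow_const _).ennreal_ofReal

/-- The trace inequality for functions dominated by a parabolic potential. -/
theorem exists_integral_norm_mul_rpow_le (d : ℕ) {α β p q : ℝ} (hα : 1 < α) (hα2 : α < 2)
    (hp : 1 < p) (hq : 1 < q) (hβ : β * p = α - 1) :
    ∃ C : ℝ, 0 < C ∧ ∀ b : SpaceTime d → EuclideanSpace ℝ (Fin d),
      MemMorrey d α q (fun z => ‖b z‖ ^ (1 / (α - 1))) →
      ∀ f : SpaceTime d → ℝ, Continuous f → HasCompactSupport f →
      ∀ u : SpaceTime d → ℝ, StronglyMeasurable u →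
        (∀ z, ‖u z‖ₑ ≤
          ∫⁻ y, ENNReal.ofReal (parabolicNorm α (z - y) ^ (β - (d + α))) * ‖f y‖ₑ) →
        Integrable (fun z => ‖b z‖ * |u z| ^ p) volume ∧
          ∫ z, ‖b z‖ * |u z| ^ p ≤
            C ^ p * (morreyNorm d α q (fun z => ‖b z‖ ^ (1 / (α - 1)))).toReal ^ (α - 1) *
              (eLpNorm f (ENNReal.ofReal p) volume).toReal ^ p := by
  have hα1 : 0 < α - 1 := by linarith
  have hp0 : 0 < p := by linarith
  have hq0 : 0 < q := by linarith
  have hβ0 : 0 < β := by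
    by_contra h
    nlinarith
  have hβQ : β < d + α := by
    have : (0 : ℝ) ≤ d := Nat.cast_nonneg d
    nlinarith
  have hr : 1 < q / (α - 1) := by rw [one_lt_div hα1]; linarith
  obtain ⟨C, hC, H⟩ := exists_lintegral_mul_parabolicPotential_rpow_le d hα hβ0 hβQ hp hr
  set a := 2 * volume (ball (0 : EuclideanSpace ℝ (Fin d)) 1) with ha
  have hat : a ≠ ∞ := ENNReal.mul_ne_top (by simp) measure_ball_lt_top.ne
  set D := C * a ^ ((α - 1) / q) with hD
  have hDt : D ≠ ∞ := ENNReal.mul_ne_top hC (ENNReal.rpow_ne_top_of_nonneg (by positivity) hat)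
  refine ⟨(D.toReal + 1) ^ (1 / p), by positivity, ?_⟩
  intro b hb f hfc hfs u hu hle
  set K := morreyNorm d α q (fun z => ‖b z‖ ^ (1 / (α - 1))) with hK
  have hKt : K ≠ ∞ := hb.norm_lt_top.ne
  have hV : AEMeasurable (fun z => ‖b z‖ₑ) volume :=
    aemeasurable_enorm_of_norm_rpow (by positivity) hb.aestronglyMeasurable
  have hbound := H (fun z => ‖b z‖ₑ) (a * K ^ q) hV
    (ENNReal.mul_ne_top hat (ENNReal.rpow_ne_top_of_nonneg hq0.le hKt)) (fun z t ht => by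
      have h := setLIntegral_parabolicNorm_sub_lt_le (α := α) (by linarith) hq0 ht
        (fun z => ‖b z‖ ^ (1 / (α - 1))) z
      rw [hβ, mul_div_cancel₀ _ hα1.ne']
      refine le_trans (le_of_eq (lintegral_congr fun y => ?_)) h
      rw [Real.enorm_rpow_of_nonneg (norm_nonneg _) (by positivity), enorm_norm,
        ← ENNReal.rpow_mul, one_div_mul_eq_div]) (fun y => ‖f y‖ₑ) hfc.measurable.enorm
  have hLp : MemLp f (ENNReal.ofReal p) volume := hfc.memLp_of_hasCompactSupport hfs
  set F := eLpNorm f (ENNReal.ofReal p) volume with hF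
  have hFint : ∫⁻ y, ‖f y‖ₑ ^ p = F ^ p := by
    rw [hF, eLpNorm_eq_lintegral_rpow_enorm_toReal (by simpa using hp0) ENNReal.ofReal_ne_top,
      ENNReal.toReal_ofReal hp0.le, ← ENNReal.rpow_mul, one_div_mul_cancel hp0.ne',
      ENNReal.rpow_one]
  have hKexp : (a * K ^ q) ^ (1 / (q / (α - 1))) = a ^ ((α - 1) / q) * K ^ (α - 1) := by
    rw [one_div_div, ENNReal.mul_rpow_of_nonneg _ _ (by positivity), ← ENNReal.rpow_mul,
      mul_div_cancel₀ _ hq0.ne']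
  have hmain : ∫⁻ z, ‖‖b z‖ * |u z| ^ p‖ₑ ≤ D * K ^ (α - 1) * F ^ p := by
    rw [hFint, hKexp] at hbound
    refine le_trans (lintegral_mono fun z => ?_) (hbound.trans (le_of_eq (by rw [hD]; ring)))
    rw [enorm_mul, enorm_norm, Real.enorm_rpow_of_nonneg (abs_nonneg _) hp0.le, Real.enorm_abs]
    gcongr
    exact hle z
  have htop : D * K ^ (α - 1) * F ^ p ≠ ∞ :=
    ENNReal.mul_ne_top (ENNReal.mul_ne_top hDt (ENNReal.rpow_ne_top_of_nonneg hα1.le hKt))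
      (ENNReal.rpow_ne_top_of_nonneg hp0.le hLp.eLpNorm_ne_top)
  have hbm : AEMeasurable (fun z => ‖b z‖) volume := by
    simpa using hV.ennreal_toReal
  refine ⟨⟨(hbm.mul ((hu.measurable.abs).pow_const p).aemeasurable).aestronglyMeasurable,
    hmain.trans_lt htop.lt_top⟩, ?_⟩
  calc ∫ z, ‖b z‖ * |u z| ^ p ≤ ‖∫ z, ‖b z‖ * |u z| ^ p‖ := le_abs_self _
    _ = ‖∫ z, ‖b z‖ * |u z| ^ p‖ₑ.toReal := (toReal_enorm _).symm
    _ ≤ (D * K ^ (α - 1) * F ^ p).toReal :=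
        ENNReal.toReal_mono htop ((enorm_integral_le_lintegral_enorm _).trans hmain)
    _ = D.toReal * K.toReal ^ (α - 1) * F.toReal ^ p := by
        rw [ENNReal.toReal_mul, ENNReal.toReal_mul, ← ENNReal.toReal_rpow, ← ENNReal.toReal_rpow]
    _ ≤ _ := by
        rw [← Real.rpow_mul (by positivity), one_div_mul_cancel hp0.ne', Real.rpow_one]
        gcongr
        linarith

end AdamsKrylov

theorem proposition1 (d : ℕ) (hd : 2 ≤ d) (α : ℝ) (hα1 : 1 < α) (hα2 : α < 2)
    (q : ℝ) (hq1 : 1 < q) (hq2 : q < (d : ℝ) + α) (p : ℝ) (hp : 1 < p) :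
    ∃ C : ℝ, 0 < C ∧
      ∀ b : AdamsKrylov.SpaceTime d → EuclideanSpace ℝ (Fin d),
        AdamsKrylov.MemMorrey d α q (fun z => ‖b z‖ ^ (1 / (α - 1))) →
        ∀ f : AdamsKrylov.SpaceTime d → ℝ, Continuous f → HasCompactSupport f →
          (Integrable
              (fun z => ‖b z‖ * |AdamsKrylov.P d α ((1 - 1 / α) * (2 / p)) f z| ^ p) volume ∧
            ∫ z, ‖b z‖ * |AdamsKrylov.P d α ((1 - 1 / α) * (2 / p)) f z| ^ p ≤
              C ^ p *
                (AdamsKrylov.morreyNorm d α q (fun z => ‖b z‖ ^ (1 / (α - 1)))).toReal ^ (α - 1) *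
                (eLpNorm f (ENNReal.ofReal p) volume).toReal ^ p) ∧
          (Integrable
              (fun z => ‖b z‖ * |AdamsKrylov.PStar d α ((1 - 1 / α) * (2 / p)) f z| ^ p) volume ∧
            ∫ z, ‖b z‖ * |AdamsKrylov.PStar d α ((1 - 1 / α) * (2 / p)) f z| ^ p ≤
              C ^ p *
                (AdamsKrylov.morreyNorm d α q (fun z => ‖b z‖ ^ (1 / (α - 1)))).toReal ^ (α - 1) *
                (eLpNorm f (ENNReal.ofReal p) volume).toReal ^ p) := by
  have hp0 : 0 < p := by linarith
  have hβ : (α - 1) / p * p = α - 1 := div_mul_cancel₀ _ hp0.ne'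
  have hβ0 : 0 < (α - 1) / p := div_pos (by linarith) hp0
  have hγ : (1 - 1 / α) * (2 / p) / 2 = (α - 1) / p / α := by field_simp
  obtain ⟨C, hC, h⟩ := AdamsKrylov.exists_integral_norm_mul_rpow_le d hα1 hα2 hp hq1 hβ
  refine ⟨C, hC, fun b hb f hfc hfs => ⟨?_, ?_⟩⟩
  · exact h b hb f hfc hfs _ (AdamsKrylov.stronglyMeasurable_P d α _ hfc.measurable)
      (AdamsKrylov.enorm_P_le hβ0 hγ hfc.measurable)
  · exact h b hb f hfc hfs _ (AdamsKrylov.stronglyMeasurable_PStar d α _ hfc.measurable)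
      (AdamsKrylov.enorm_PStar_le hβ0 hγ hfc.measurable)
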